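/- For $n\ge 0$ let $h_n(x)=(2^n n!)^{-1/2}\pi^{-1/4}H_n(x)e^{-x^2/2}\in L^2(\mathbb R)$ be the Hermite functions ($H_n$ the Hermite polynomial of degree $n$), write $|n\rangle=h_n$, and let $\mathcal H^N=\mathrm{span}_{\mathbb C}\{|n\rangle:\,0\le n\le N\}$. Let $\mathcal H\subseteq\mathcal H^N$ be a linear subspace for some $N\in\mathbb N_0$, and let $\mathcal D(\mathcal H)$ be the set of density matrices on $\mathcal H$, i.e. positive (self-adjoint) operators $\rho:\mathcal H\to\mathcal H$ with $\mathrm{tr}\,\rho=1$. For an operator $\rho$ on $\mathcal H$ let $K_\rho(x,y)=\sum_i (\rho e_i)(x)\overline{e_i(y)}$, where $(e_i)$ is an orthonormal basis of $\mathcal H$, be its integral kernel and $$W\rho(x,\xi)=\frac1{2\pi}\int_{\mathbb R}e^{-i\xi y}K_\rho\Bigl(x+\frac y2,x-\frac y2\Bigr)\,dy,\qquad (x,\xi)\in\mathbb R^2,$$ its Wigner function (it does not depend on the choice of basis). Let $\mathcal D_+(\mathcal H)=\{\rho\in\mathcal D(\mathcal H): W\rho(z)\ge 0 \text{ for all } z\in\mathbb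 R^2\}$ be the convex set of Wigner-positive states, let $\mathcal D_{0+}(\mathcal H)$ be the set of those $\rho\in\mathcal D_+(\mathcal H)$ whose nodal set $\mathcal N(\rho)=\{z\in\mathbb R^2: W\rho(z)=0\}$ is nonempty, and let $\mathrm{Extr}$ denote the set of extreme points. Then: 1. if $|0\rangle\in\mathcal H$, then $\mathrm{Extr}(\mathcal D_+(\mathcal H))\subseteq\mathcal D_{0+}(\mathcal H)\cup\{|0\rangle\langle 0|\}$, where $|0\rangle\langle 0|$ is the orthogonal projector of $\mathcal H$ onto the span of $|0\rangle$; 2. if $|0\rangle\notin\mathcal H$, then $\mathrm{Extr}(\mathcal D_+(\mathcal H))\subseteq\mathcal D_{0+}(\mathcal H)$. -/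

import Mathlib

/-- The Hilbert space `L²(ℝ)` of square-integrable complex functions on the line. -/
abbrev L2R : Type := MeasureTheory.Lp ℂ 2 (MeasureTheory.volume : MeasureTheory.Measure ℝ)

/-- The (physicists') Hermite polynomials: `H₀ = 1`, `Hₙ₊₁ = 2 X Hₙ - Hₙ'`. -/
noncomputable def physHermite : ℕ → Polynomial ℝ
  | 0 => 1
  | n + 1 => 2 * Polynomial.X * physHermite n - Polynomial.derivative (physHermite n)

/-- The Hermite function `hₙ(x) = (2ⁿ n!)^{-1/2} π^{-1/4} Hₙ(x) e^{-x²/2}`. -/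
noncomputable def hermiteFun (n : ℕ) (x : ℝ) : ℂ :=
  (((2 ^ n * (n.factorial : ℝ)) ^ (-(1 / 2) : ℝ) * Real.pi ^ (-(1 / 4) : ℝ) *
    (physHermite n).eval x * Real.exp (-(1 / 2) * x ^ 2) : ℝ) : ℂ)

/-- A polynomial times the Gaussian `e^{-x²}` is integrable. -/
theorem integrable_polynomial_mul_gaussian (p : Polynomial ℝ) :
    MeasureTheory.Integrable (fun x : ℝ => p.eval x * Real.exp (-1 * x ^ 2)) := by
  induction p using Polynomial.induction_on' with
  | add p q hp hq =>
    refine (hp.add hq).congr (Filter.Eventually.of_forall fun x => ?_)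
    simp [add_mul]
  | monomial n a =>
    have h := (integrable_rpow_mul_exp_neg_mul_sq (b := 1) one_pos (s := (n : ℝ))
      (by have : (0 : ℝ) ≤ n := n.cast_nonneg
          linarith)).const_mul a
    refine h.congr (Filter.Eventually.of_forall fun x => ?_)
    simp [mul_assoc]

theorem memLp_hermiteFun (n : ℕ) :
    MeasureTheory.MemLp (hermiteFun n) 2 (MeasureTheory.volume : MeasureTheory.Measure ℝ) := by
  have hc : Continuous (hermiteFun n) := by
    unfold hermiteFun
    fun_prop
  rw [MeasureTheory.memLp_two_iff_integrable_sq_norm hc.aestronglyMeasurable]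
  refine ((integrable_polynomial_mul_gaussian (physHermite n ^ 2)).const_mul
    (((2 ^ n * (n.factorial : ℝ)) ^ (-(1 / 2) : ℝ) * Real.pi ^ (-(1 / 4) : ℝ)) ^ 2)).congr
    (Filter.Eventually.of_forall fun x => ?_)
  have he : Real.exp (-1 * x ^ 2) = Real.exp (-(1 / 2) * x ^ 2) ^ 2 := by
    rw [← Real.exp_nat_mul]
    congr 1
    push_cast
    ring
  simp only [hermiteFun, Complex.norm_real, Real.norm_eq_abs, sq_abs, Polynomial.eval_pow, he]
  ring

/-- The Fock state `|n⟩ = hₙ`, as an element of `L²(ℝ)`. -/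
noncomputable def fock (n : ℕ) : L2R := (memLp_hermiteFun n).toLp (hermiteFun n)

/-- The finite-dimensional space `ℋ^N = span {|n⟩ : 0 ≤ n ≤ N}`. -/
noncomputable def fockSpace (N : ℕ) : Submodule ℂ L2R :=
  Submodule.span ℂ (fock '' Set.Iic N)

theorem finiteDimensional_of_le_fockSpace {N : ℕ} {H : Submodule ℂ L2R}
    (hH : H ≤ fockSpace N) : FiniteDimensional ℂ H := by
  have : FiniteDimensional ℂ (fockSpace N) :=
    FiniteDimensional.span_of_finite ℂ ((Set.finite_Iic N).image fock)
  exact Submodule.finiteDimensional_of_le hH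

section States

variable (H : Submodule ℂ L2R) [FiniteDimensional ℂ H]

/-- The set `𝒟(H)` of density matrices on `H`: positive (in particular self-adjoint) operators
`H → H` with unit trace (every operator on the finite-dimensional space `H` is trace class). -/
def densityOps : Set (H →L[ℂ] H) :=
  {ρ | ρ.IsPositive ∧ LinearMap.trace ℂ H (ρ : H →ₗ[ℂ] H) = 1}

variable {H}

/-- The integral kernel of an operator `ρ` on `H`:
`K_ρ(x, y) = ∑ᵢ (ρ eᵢ)(x) * conj (eᵢ(y))` for an orthonormal basis `(eᵢ)` of `H`.
Another basis changes it only on a set `(A × ℝ) ∪ (ℝ × A)` with `A` a null set. -/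
noncomputable def opKernel (ρ : H →L[ℂ] H) (x y : ℝ) : ℂ :=
  ∑ i, ((ρ (stdOrthonormalBasis ℂ H i) : H) : L2R) x *
    (starRingEnd ℂ) (((stdOrthonormalBasis ℂ H i : H) : L2R) y)

/-- `opKernel ρ` is an integral kernel of `ρ`: `(ρ ψ)(x) = ∫ K_ρ(x, y) ψ(y) dy`. -/
theorem opKernel_spec (ρ : H →L[ℂ] H) (ψ : H) :
    (((ρ ψ : H) : L2R) : ℝ → ℂ) =ᵐ[MeasureTheory.volume]
      fun x => ∫ y, opKernel ρ x y * ((ψ : L2R) y) := by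
  have hint : ∀ i, MeasureTheory.Integrable (fun y =>
      (starRingEnd ℂ) (((stdOrthonormalBasis ℂ H i : H) : L2R) y) * ((ψ : L2R) y)) := by
    intro i
    have h := MeasureTheory.L2.integrable_inner (𝕜 := ℂ)
      ((stdOrthonormalBasis ℂ H i : H) : L2R) (ψ : L2R)
    simpa [RCLike.inner_apply, mul_comm] using h
  have hin : ∀ i, ∫ y, (starRingEnd ℂ) (((stdOrthonormalBasis ℂ H i : H) : L2R) y) *
      ((ψ : L2R) y) = inner ℂ (stdOrthonormalBasis ℂ H i) ψ := by
    intro i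
    rw [Submodule.coe_inner, MeasureTheory.L2.inner_def]
    simp [RCLike.inner_apply, mul_comm]
  have hsum : ((ρ ψ : H) : L2R) = ∑ i, (inner ℂ (stdOrthonormalBasis ℂ H i) ψ : ℂ) •
      ((ρ (stdOrthonormalBasis ℂ H i) : H) : L2R) := by
    conv_lhs => rw [← (stdOrthonormalBasis ℂ H).sum_repr' ψ]
    simp
  have hs : ∀ᵐ x, ∀ i, ((((inner ℂ (stdOrthonormalBasis ℂ H i) ψ : ℂ) •
      ((ρ (stdOrthonormalBasis ℂ H i) : H) : L2R) : L2R)) : ℝ → ℂ) x =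
      (inner ℂ (stdOrthonormalBasis ℂ H i) ψ : ℂ) *
        ((ρ (stdOrthonormalBasis ℂ H i) : H) : L2R) x := by
    rw [MeasureTheory.ae_all_iff]
    intro i
    filter_upwards [MeasureTheory.Lp.coeFn_smul (inner ℂ (stdOrthonormalBasis ℂ H i) ψ : ℂ)
      ((ρ (stdOrthonormalBasis ℂ H i) : H) : L2R)] with x hx
    simpa using hx
  rw [hsum]
  filter_upwards [hs, MeasureTheory.Lp.coeFn_finsetSum Finset.univ (fun i =>
    (inner ℂ (stdOrthonormalBasis ℂ H i) ψ : ℂ) •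
      ((ρ (stdOrthonormalBasis ℂ H i) : H) : L2R))] with x hx hx2
  rw [hx2, Finset.sum_apply]
  simp only [opKernel, Finset.sum_mul, mul_assoc]
  rw [MeasureTheory.integral_finsetSum _ (fun i _ => (hint i).const_mul _)]
  refine Finset.sum_congr rfl fun i _ => ?_
  rw [hx i, MeasureTheory.integral_const_mul, hin i, mul_comm]

/-- The Wigner function
`Wρ(x, ξ) = (2π)⁻¹ ∫ e^{-iξy} K_ρ(x + y/2, x - y/2) dy` of an operator `ρ` on `H`. -/
noncomputable def wigner (ρ : H →L[ℂ] H) (z : ℝ × ℝ) : ℂ :=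
  1 / (2 * Real.pi) * ∫ y : ℝ, Complex.exp (-Complex.I * z.2 * y) *
    opKernel ρ (z.1 + y / 2) (z.1 - y / 2)

/-- The nodal set `𝒩(ρ)`, the zero set of the Wigner function. -/
def nodalSet (ρ : H →L[ℂ] H) : Set (ℝ × ℝ) := {z | wigner ρ z = 0}

variable (H)

open scoped ComplexOrder in
/-- The set `𝒟₊(H)` of Wigner-positive states (in `ℂ`, `0 ≤ w` says that `w` is real and
nonnegative). -/
def wignerPositiveStates : Set (H →L[ℂ] H) := {ρ ∈ densityOps H | ∀ z, 0 ≤ wigner ρ z}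

/-- The set `𝒟₀₊(H)` of Wigner-positive states with nonempty nodal set. -/
def nodalWignerPositiveStates : Set (H →L[ℂ] H) :=
  {ρ ∈ wignerPositiveStates H | (nodalSet ρ).Nonempty}

end States

/-!
Every vector of `H` has the form `p(x) e^{-x²/2}` with a polynomial `p`. Shifting a contour of
integration in the definition shows that its Wigner function is
`W(x, ξ) = π⁻¹ e^{-(x² + ξ²)} P(x - iξ)` with `P(w) = ∫ e^{-t²} p(w + t) conj (p(w - t)) dt`
(`wignerPoly`), and that `P(w)` grows like a positive multiple of `|w| ^ (2 deg p)`
(`tendsto_wignerPoly_div`).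

Let `ρ` be an extreme point of the Wigner-positive states with empty nodal set, and write
`ρ = ∑ᵢ |uᵢ⟩⟨uᵢ|`. Let `v` be the `uᵢ` whose polynomial has the highest degree. As the leading
terms of the summands are nonnegative, there is no cancellation at infinity, so
`W(|v⟩⟨v|) ≤ c Wρ` for some constant `c` (`exists_norm_wignerPoly_le`); also `|v⟩⟨v| ≤ ρ`. Hence
`ρ ± ε (|v⟩⟨v| - ‖v‖² ρ)` are Wigner-positive states for small `ε > 0`, and extremality gives
`|v⟩⟨v| = ‖v‖² ρ` (`IsPolynomialPart.eq_smul_of_mem_extremePoints`): the state is pure.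

A pure state with strictly positive Wigner function is Gaussian by Hudson's theorem, which has a
short proof here (`natDegree_eq_zero_of_wignerPoly_pos`). If `deg p > 0`, the overlap with coherent
states, `s ↦ ∫ e^{-t²} p(s + t) dt`, is a nonconstant polynomial and has a root `s`. But the average
of `P` against `e^{-2|w - s|²}` is a positive multiple of the squared modulus of this overlap, so it
would vanish although `P > 0`. Thus `p` is constant, and `ρ` is the projector onto `|0⟩`.
-/

section

open Polynomial MeasureTheory Filter Topology ComplexConjugate InnerProductSpace

open scoped ComplexOrder

/-! ### Gaussian integrals of polynomials -/

theorem integrable_cexp_mul_eval (ξ : ℝ) (q : ℂ[X]) :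
    Integrable fun t : ℝ =>
      Complex.exp (-(t : ℂ) ^ 2 - 2 * Complex.I * ξ * t) * q.eval (t : ℂ) := by
  have hexp : ∀ t : ℝ, ‖Complex.exp (-(t : ℂ) ^ 2 - 2 * Complex.I * ξ * t)‖ =
      Real.exp (-1 * t ^ 2) := by
    intro t
    rw [Complex.norm_exp]
    congr 1
    simp [← Complex.ofReal_pow]
  induction q using Polynomial.induction_on' with
  | add p q hp hq =>
    refine (hp.add hq).congr (Eventually.of_forall fun t => ?_)
    simp [mul_add]
  | monomial n a =>
    have h := ((integrable_polynomial_mul_gaussian (X ^ n)).norm.const_mul ‖a‖)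
    refine h.mono' (Continuous.aestronglyMeasurable (by fun_prop))
      (Eventually.of_forall fun t => ?_)
    rw [norm_mul, hexp]
    simp only [eval_monomial, eval_pow, eval_X, norm_mul, norm_pow, Complex.norm_real,
      Real.norm_eq_abs, Real.abs_exp]
    apply le_of_eq
    ring

/-- The linear functional `q ↦ ∫ e^{-t² - 2iξt} q(t) dt` on polynomials. For `ξ = 0` this is
integration against the Gaussian `e^{-t²}`. -/
noncomputable def gaussianPairing (ξ : ℝ) : ℂ[X] →ₗ[ℂ] ℂ where
  toFun q := ∫ t : ℝ, Complex.exp (-(t : ℂ) ^ 2 - 2 * Complex.I * ξ * t) * q.eval (t : ℂ)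
  map_add' p q := by
    simp only [eval_add, mul_add]
    exact integral_add (integrable_cexp_mul_eval ξ p) (integrable_cexp_mul_eval ξ q)
  map_smul' c q := by
    simp only [eval_smul, smul_eq_mul, RingHom.id_apply]
    rw [← integral_const_mul]
    congr 1 with t
    ring

theorem gaussianPairing_apply (ξ : ℝ) (q : ℂ[X]) : gaussianPairing ξ q =
    ∫ t : ℝ, Complex.exp (-(t : ℂ) ^ 2 - 2 * Complex.I * ξ * t) * q.eval (t : ℂ) := rfl

theorem gaussianPairing_zero_apply (q : ℂ[X]) : gaussianPairing 0 q =
    ∫ t : ℝ, Complex.exp (-(t : ℂ) ^ 2) * q.eval (t : ℂ) := by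
  simp [gaussianPairing_apply]

theorem gaussianPairing_one (ξ : ℝ) :
    gaussianPairing ξ 1 = Real.sqrt Real.pi * Complex.exp (-(ξ : ℂ) ^ 2) := by
  have h := integral_cexp_quadratic (b := -1) (by simp) (-2 * Complex.I * ξ) 0
  rw [gaussianPairing_apply]
  have e : ∀ t : ℝ, Complex.exp (-(t : ℂ) ^ 2 - 2 * Complex.I * ξ * t) * (1 : ℂ[X]).eval (t : ℂ) =
      Complex.exp (-1 * (t : ℂ) ^ 2 + -2 * Complex.I * ξ * t + 0) := by
    intro t; simp [sub_eq_add_neg]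
  simp_rw [e, h]
  congr 1
  · rw [Real.sqrt_eq_rpow, Complex.ofReal_cpow Real.pi_pos.le]
    simp
  · congr 1
    ring_nf
    simp

/-- Integration by parts: the integrand is the derivative of `e^{-t² - 2iξt} q(t)`. -/
theorem gaussianPairing_derivative (ξ : ℝ) (q : ℂ[X]) :
    gaussianPairing ξ (derivative q - 2 * (X + C (Complex.I * ξ)) * q) = 0 := by
  rw [gaussianPairing_apply]
  refine integral_eq_zero_of_hasDerivAt_of_integrable
    (f := fun t : ℝ => Complex.exp (-(t : ℂ) ^ 2 - 2 * Complex.I * ξ * t) * q.eval (t : ℂ))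
    (fun t => ?_) (integrable_cexp_mul_eval ξ _) (integrable_cexp_mul_eval ξ q)
  have h1 : HasDerivAt (fun z : ℂ => -z ^ 2 - 2 * Complex.I * ξ * z)
      (-(2 * (t : ℂ)) - 2 * Complex.I * ξ) (t : ℂ) := by
    have := ((hasDerivAt_pow 2 (t : ℂ)).neg).sub
      ((hasDerivAt_id (t : ℂ)).const_mul (2 * Complex.I * ξ))
    refine this.congr_deriv ?_
    simp
  have h2 := (h1.cexp.mul (q.hasDerivAt (t : ℂ))).comp_ofReal
  refine h2.congr_deriv ?_
  simp only [eval_sub, eval_mul, eval_add, eval_X, eval_C, eval_ofNat]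
  ring

/-- A linear functional annihilating all `q' - 2 (X + a) q` is determined by its value at `1`. -/
theorem eq_of_apply_derivative_eq_zero {φ ψ : ℂ[X] →ₗ[ℂ] ℂ} (a : ℂ)
    (hφ : ∀ q, φ (derivative q - 2 * (X + C a) * q) = 0)
    (hψ : ∀ q, ψ (derivative q - 2 * (X + C a) * q) = 0) (h1 : φ 1 = ψ 1) : φ = ψ := by
  -- For `n = 0` the truncated exponent `n - 1` does no harm, as its coefficient `n / 2` vanishes.
  have key : ∀ n : ℕ, (X ^ (n + 1) : ℂ[X]) =
      C (n / 2 : ℂ) * X ^ (n - 1) - C a * X ^ n -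
        C (1 / 2 : ℂ) * (derivative (X ^ n) - 2 * (X + C a) * X ^ n) := by
    intro n
    have h2 : (2 : ℂ[X]) = C 2 := rfl
    have h3 : (C (1 / 2 : ℂ) : ℂ[X]) * C 2 = 1 := by rw [← C_mul]; norm_num
    rw [derivative_X_pow, h2, div_eq_mul_one_div (n : ℂ), C_mul]
    linear_combination (-X ^ n * X - X ^ n * C a) * h3
  suffices ∀ n : ℕ, φ (X ^ n) = ψ (X ^ n) by
    refine Polynomial.lhom_ext' fun n => LinearMap.ext_ring ?_
    simpa [← C_mul_X_pow_eq_monomial] using this n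
  intro n
  induction n using Nat.strong_induction_on with
  | _ n ih =>
    rcases n with _ | n
    · simpa using h1
    · rw [key n]
      simp only [map_sub, ← smul_eq_C_mul, map_smul]
      rw [← map_sub φ, ← map_sub ψ, hφ, hψ, ih n (by omega)]
      rw [ih (n - 1) (by omega)]

/-- Shifting the contour of integration by `-iξ` completes the square in the exponent. -/
theorem gaussianPairing_eq_shift (ξ : ℝ) (q : ℂ[X]) : gaussianPairing ξ q =
    Complex.exp (-(ξ : ℂ) ^ 2) * gaussianPairing 0 (q.comp (X - C (Complex.I * ξ))) := by
  let ψ : ℂ[X] →ₗ[ℂ] ℂ := Complex.exp (-(ξ : ℂ) ^ 2) •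
    (gaussianPairing 0 ∘ₗ (aeval (X - C (Complex.I * ξ)) : ℂ[X] →ₐ[ℂ] ℂ[X]).toLinearMap)
  have hψ : ∀ q, ψ q = Complex.exp (-(ξ : ℂ) ^ 2) *
      gaussianPairing 0 (q.comp (X - C (Complex.I * ξ))) := fun q => by
    simp [ψ, comp_eq_aeval]
  rw [← hψ]
  refine DFunLike.congr_fun (eq_of_apply_derivative_eq_zero (Complex.I * ξ)
    (gaussianPairing_derivative ξ) (fun q => ?_) ?_) q
  · have h := gaussianPairing_derivative 0 (q.comp (X - C (Complex.I * ξ)))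
    rw [hψ, ← mul_zero (Complex.exp (-(ξ : ℂ) ^ 2)), ← h]
    congr 2
    simp only [derivative_comp, sub_comp, mul_comp, add_comp, X_comp, C_comp, ofNat_comp]
    simp
  · rw [hψ, one_comp, gaussianPairing_one, gaussianPairing_one]
    simp [mul_comm]

/-! ### The polynomial part of a Wigner function -/

/-- The polynomial in `t` whose value at real `t` is `f(w + t) * conj (g(w - t))`; see
`eval_weylProduct`. As a function of complex `t` it is `f(w + t) * g*(conj w - t)`, where `g*` has
the conjugate coefficients, so that contours of integration can be shifted. -/
noncomputable def weylProduct (f g : ℂ[X]) (w : ℂ) : ℂ[X] :=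
  f.comp (X + C w) * (g.map (starRingEnd ℂ)).comp (C (conj w) - X)

theorem eval_weylProduct (f g : ℂ[X]) (w : ℂ) (t : ℝ) :
    (weylProduct f g w).eval (t : ℂ) = f.eval (w + t) * conj (g.eval (w - t)) := by
  have h : conj (g.eval (w - t)) = (g.map (starRingEnd ℂ)).eval (conj w - t) := by
    rw [← Complex.conj_ofReal t, ← map_sub, Complex.conj_ofReal, eval_map_apply]
  simp [weylProduct, h, add_comm]

/-- The function `w ↦ ∫ e^{-t²} f(w + t) conj (g(w - t)) dt`. Taken at `w = x - iξ`, it is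
`π e^{x² + ξ²}` times the cross-Wigner function at `(x, ξ)` of the functions `f(x) e^{-x²/2}` and
`g(x) e^{-x²/2}`. -/
noncomputable def wignerPoly (f g : ℂ[X]) (w : ℂ) : ℂ := gaussianPairing 0 (weylProduct f g w)

/-- The oscillating integral that defines the Wigner function, as a function of `x - iξ` times a
Gaussian factor. -/
theorem gaussianPairing_weylProduct (f g : ℂ[X]) (x ξ : ℝ) :
    gaussianPairing ξ (weylProduct f g x) =
      Complex.exp (-(ξ : ℂ) ^ 2) * wignerPoly f g (x - Complex.I * ξ) := by
  rw [gaussianPairing_eq_shift, wignerPoly]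
  congr 2
  simp only [weylProduct, mul_comp, comp_assoc, sub_comp, add_comp, X_comp, C_comp]
  congr 2
  · simp; ring
  · simp; ring

theorem comp_X_add_C_eq_sum (f : ℂ[X]) {n : ℕ} (hn : f.natDegree ≤ n) (w : ℂ) :
    f.comp (X + C w) = ∑ k ∈ Finset.range (n + 1), C ((hasseDeriv k f).eval w) * X ^ k := by
  rw [← taylor_apply, as_sum_range' (taylor w f) (n + 1) (by rw [natDegree_taylor]; omega)]
  simp_rw [taylor_coeff, C_mul_X_pow_eq_monomial]

theorem gaussianPairing_comp_X_add_C (f : ℂ[X]) (w : ℂ) :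
    gaussianPairing 0 (f.comp (X + C w)) = ∑ k ∈ Finset.range (f.natDegree + 1),
      gaussianPairing 0 (X ^ k) * (hasseDeriv k f).eval w := by
  rw [comp_X_add_C_eq_sum f le_rfl, map_sum]
  refine Finset.sum_congr rfl fun k _ => ?_
  rw [← smul_eq_C_mul, map_smul, smul_eq_mul, mul_comm]

/-- Expansion of `wignerPoly f f` by Taylor's formula in the integration variable. -/
theorem wignerPoly_self_expand (f : ℂ[X]) {n : ℕ} (hn : f.natDegree ≤ n) (w : ℂ) :
    wignerPoly f f w = ∑ j ∈ Finset.range (n + 1), ∑ k ∈ Finset.range (n + 1),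
      (-1) ^ k * gaussianPairing 0 (X ^ (j + k)) *
        ((hasseDeriv j f).eval w * conj ((hasseDeriv k f).eval w)) := by
  have h1 := comp_X_add_C_eq_sum f hn w
  have h2 : (f.map (starRingEnd ℂ)).comp (C (conj w) - X) = ∑ k ∈ Finset.range (n + 1),
      C ((-1) ^ k * conj ((hasseDeriv k f).eval w)) * X ^ k := by
    have e : (f.map (starRingEnd ℂ)).comp (C (conj w) - X) =
        ((f.comp (X + C w)).map (starRingEnd ℂ)).comp (-X) := by
      rw [Polynomial.map_comp, comp_assoc]
      congr 1
      simp; ring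
    rw [e, h1, Polynomial.map_sum, Polynomial.sum_comp]
    refine Finset.sum_congr rfl fun k _ => ?_
    simp [neg_pow (X : ℂ[X])]
    ring
  rw [wignerPoly, weylProduct, h1, h2, Finset.sum_mul_sum]
  simp_rw [map_sum]
  refine Finset.sum_congr rfl fun j _ => Finset.sum_congr rfl fun k _ => ?_
  have : C ((hasseDeriv j f).eval w) * X ^ j *
      (C ((-1) ^ k * conj ((hasseDeriv k f).eval w)) * X ^ k) =
      ((hasseDeriv j f).eval w * ((-1) ^ k * conj ((hasseDeriv k f).eval w))) •
        (X ^ (j + k) : ℂ[X]) := by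
    rw [smul_eq_C_mul, C_mul, C_mul, C_mul, pow_add]; ring
  rw [this, map_smul, smul_eq_mul]
  ring

theorem continuous_wignerPoly_self (f : ℂ[X]) : Continuous (wignerPoly f f) := by
  simp_rw [funext (wignerPoly_self_expand f le_rfl)]
  have h (q : ℂ[X]) : Continuous fun w => conj (q.eval w) :=
    Complex.continuous_conj.comp q.continuous
  fun_prop

theorem tendsto_eval_div_pow {f : ℂ[X]} {n : ℕ} (hn : f.natDegree ≤ n) :
    Tendsto (fun w => f.eval w / w ^ n) (cocompact ℂ) (𝓝 (f.coeff n)) := by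
  rw [← Metric.cobounded_eq_cocompact]
  have h : Tendsto (fun w : ℂ => (∑ k ∈ Finset.range n, f.coeff k * (w⁻¹) ^ (n - k)) + f.coeff n)
      (Bornology.cobounded ℂ) (𝓝 ((∑ k ∈ Finset.range n, f.coeff k * 0 ^ (n - k)) + f.coeff n)) :=
    (tendsto_finsetSum _ fun k _ => (tendsto_inv₀_cobounded.pow _).const_mul _).add_const _
  have z : (∑ k ∈ Finset.range n, f.coeff k * (0 : ℂ) ^ (n - k)) = 0 :=
    Finset.sum_eq_zero fun k hk => by
      rw [zero_pow (by have := Finset.mem_range.1 hk; omega), mul_zero]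
  rw [z, zero_add] at h
  refine h.congr' ?_
  have h0 : ∀ᶠ w : ℂ in Bornology.cobounded ℂ, w ≠ 0 := Bornology.eventually_ne_cobounded 0
  filter_upwards [h0] with w hw
  rw [eval_eq_sum_range' (n := n + 1) (by omega), Finset.sum_range_succ, add_div,
    mul_div_cancel_right₀ _ (pow_ne_zero _ hw), Finset.sum_div]
  congr 1
  refine Finset.sum_congr rfl fun k hk => ?_
  have := Finset.mem_range.1 hk
  rw [inv_pow, pow_sub₀ w hw this.le]
  field_simp

/-- At infinity `wignerPoly f f w` grows like a positive multiple of `‖w‖ ^ (2 * n)` if `n` is the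
degree of `f`, and slower if `n` is larger: only the Taylor coefficient of order `0` contributes. -/
theorem tendsto_wignerPoly_div {f : ℂ[X]} {n : ℕ} (hn : f.natDegree ≤ n) :
    Tendsto (fun w => wignerPoly f f w / (‖w‖ : ℂ) ^ (2 * n)) (cocompact ℂ)
      (𝓝 (Real.sqrt Real.pi * (‖f.coeff n‖ : ℂ) ^ 2)) := by
  have hc : ∀ j, (hasseDeriv j f).natDegree ≤ n := fun j =>
    (natDegree_hasseDeriv_le f j).trans (by omega)
  have h : Tendsto (fun w => ∑ j ∈ Finset.range (n + 1), ∑ k ∈ Finset.range (n + 1),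
      (-1) ^ k * gaussianPairing 0 (X ^ (j + k)) *
        ((hasseDeriv j f).eval w / w ^ n * conj ((hasseDeriv k f).eval w / w ^ n)))
      (cocompact ℂ) (𝓝 (∑ j ∈ Finset.range (n + 1), ∑ k ∈ Finset.range (n + 1),
      (-1) ^ k * gaussianPairing 0 (X ^ (j + k)) *
        ((hasseDeriv j f).coeff n * conj ((hasseDeriv k f).coeff n)))) :=
    tendsto_finsetSum _ fun j _ => tendsto_finsetSum _ fun k _ =>
      ((tendsto_eval_div_pow (hc j)).mul
        ((Complex.continuous_conj.tendsto _).comp (tendsto_eval_div_pow (hc k)))).const_mul _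
  have hz : ∀ j, j ≠ 0 → (hasseDeriv j f).coeff n = 0 := fun j hj => by
    rw [hasseDeriv_coeff, coeff_eq_zero_of_natDegree_lt (by omega), mul_zero]
  convert h using 2 with w
  · rw [wignerPoly_self_expand f hn, Finset.sum_div]
    refine Finset.sum_congr rfl fun j _ => ?_
    rw [Finset.sum_div]
    refine Finset.sum_congr rfl fun k _ => ?_
    rw [pow_mul, ← Complex.mul_conj', map_div₀, map_pow (starRingEnd ℂ), mul_pow]
    ring
  · rw [Finset.sum_eq_single 0 (fun j _ hj => by simp [hz j hj]) (by simp),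
      Finset.sum_eq_single 0 (fun j _ hj => by simp [hz j hj]) (by simp)]
    simp [gaussianPairing_one, Complex.mul_conj']

/-! ### Hudson's theorem -/

/-- Up to a Gaussian factor and a scaling, `gaussianPairing 0 (f.comp (X + C w))` is the overlap of
`f(x) e^{-x²/2}` with a coherent state. It is a polynomial in `w` of the same degree as `f`, so it has a root. -/
theorem exists_gaussianPairing_comp_eq_zero {f : ℂ[X]} (hf : f.natDegree ≠ 0) :
    ∃ w, gaussianPairing 0 (f.comp (X + C w)) = 0 := by
  let g : ℂ[X] := ∑ k ∈ Finset.range (f.natDegree + 1),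
      C (gaussianPairing 0 (X ^ k)) * hasseDeriv k f
  have hg : g.coeff f.natDegree = Real.sqrt Real.pi * f.leadingCoeff := by
    simp only [g, finsetSum_coeff, coeff_C_mul]
    rw [Finset.sum_eq_single 0 (fun k _ hk => ?_) (by simp)]
    · simp [gaussianPairing_one]
    · rw [hasseDeriv_coeff, coeff_eq_zero_of_natDegree_lt (n := f.natDegree + k) (by omega)]
      simp
  have hg0 : g.coeff f.natDegree ≠ 0 := by
    rw [hg]
    have : f ≠ 0 := by rintro rfl; simp at hf
    have := Real.pi_pos
    exact mul_ne_zero (by exact_mod_cast (Real.sqrt_pos.2 this).ne') (leadingCoeff_ne_zero.2 ‹_›)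
  have hdeg : g.degree ≠ 0 := fun h => by
    have := le_degree_of_ne_zero hg0
    rw [h] at this
    exact hf (Nat.le_zero.1 (by exact_mod_cast this))
  obtain ⟨w, hw⟩ := IsAlgClosed.exists_root g hdeg
  refine ⟨w, ?_⟩
  rw [gaussianPairing_comp_X_add_C f, ← hw.eq_zero]
  simp [g, eval_finsetSum]

theorem re_integral_pos {f : ℝ → ℂ} (hf : Integrable f) (h : ∀ x, 0 < (f x).re) :
    0 < (∫ x, f x).re := by
  have e : (∫ x, f x).re = ∫ x, (f x).re := (integral_re hf).symm
  rw [e, integral_pos_iff_support_of_nonneg (fun x => (h x).le) hf.re]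
  have : (Function.support fun x => (f x).re) = Set.univ :=
    Set.eq_univ_of_forall fun x => (h x).ne'
  rw [this]
  simp

/-- The integrand for which `integral_exp_mul_gaussianPairing` exchanges the integrals. -/
theorem integrable_prod_gaussian (q : ℂ[X]) : Integrable (fun z : ℝ × ℝ =>
    Complex.exp (-(z.1 : ℂ) ^ 2) *
      (Complex.exp (-(z.2 : ℂ) ^ 2 - 2 * Complex.I * z.1 * z.2) * q.eval (z.2 : ℂ)))
    (volume.prod volume) := by
  have h1 := integrable_cexp_mul_eval 0 1
  have h2 := integrable_cexp_mul_eval 0 q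
  refine (h1.mul_prod h2).mono (Continuous.aestronglyMeasurable (by fun_prop))
    (Eventually.of_forall fun z => le_of_eq ?_)
  simp [Complex.norm_exp]

theorem integrable_exp_mul_gaussianPairing (q : ℂ[X]) :
    Integrable fun ξ : ℝ => Complex.exp (-(ξ : ℂ) ^ 2) * gaussianPairing ξ q := by
  simpa only [gaussianPairing_apply, integral_const_mul] using
    (integrable_prod_gaussian q).integral_prod_left

/-- Fubini, with the Fourier transform of the Gaussian carried out in `ξ`. -/
theorem integral_exp_mul_gaussianPairing (q : ℂ[X]) :
    ∫ ξ : ℝ, Complex.exp (-(ξ : ℂ) ^ 2) * gaussianPairing ξ q =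
      Real.sqrt Real.pi * ∫ t : ℝ, Complex.exp (-2 * (t : ℂ) ^ 2) * q.eval (t : ℂ) := by
  simp_rw [gaussianPairing_apply, ← integral_const_mul]
  rw [integral_integral_swap (integrable_prod_gaussian q)]
  congr 1 with t
  have h : ∀ ξ : ℝ, Complex.exp (-(ξ : ℂ) ^ 2) *
      (Complex.exp (-(t : ℂ) ^ 2 - 2 * Complex.I * ξ * t) * q.eval (t : ℂ)) =
      Complex.exp (-(t : ℂ) ^ 2) * q.eval (t : ℂ) *
        (Complex.exp (-(ξ : ℂ) ^ 2 - 2 * Complex.I * t * ξ) * (1 : ℂ[X]).eval (ξ : ℂ)) := by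
    intro ξ
    rw [eval_one, mul_one, ← mul_assoc, ← Complex.exp_add, mul_right_comm (Complex.exp _),
      ← Complex.exp_add]
    congr 2
    ring
  simp_rw [h, integral_const_mul, ← gaussianPairing_apply, gaussianPairing_one]
  have h2 : Complex.exp (-2 * (t : ℂ) ^ 2) =
      Complex.exp (-(t : ℂ) ^ 2) * Complex.exp (-(t : ℂ) ^ 2) := by
    rw [← Complex.exp_add]; ring_nf
  rw [h2]
  ring

/-- With `u(t) = e^{-t²} f(t)`, the average of `wignerPoly f f` against the Gaussian `e^{-2|w|²}`
is a positive multiple of `∫ (u ⋆ conj u)(2x) dx = |∫ u|² / 2`. -/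
theorem gaussianPairing_ne_zero_of_wignerPoly_pos {f : ℂ[X]}
    (hf : ∀ w, 0 < (wignerPoly f f w).re) : gaussianPairing 0 f ≠ 0 := by
  let u : ℝ → ℂ := fun t => Complex.exp (-(t : ℂ) ^ 2) * f.eval (t : ℂ)
  let v : ℝ → ℂ := fun t => conj (u t)
  have hu : Integrable u := by simpa [u] using integrable_cexp_mul_eval 0 f
  have hv : Integrable v := (LinearIsometryEquiv.integrable_comp_iff Complex.conjLIE).2 hu
  let L : ℂ →L[ℝ] ℂ →L[ℝ] ℂ := ContinuousLinearMap.mul ℝ ℂ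
  -- Shift the variable of the convolution by `x`, and use `(x + t)² + (x - t)² = 2x² + 2t²`.
  have hconv : ∀ x : ℝ, convolution u v L volume (2 * x) =
      Complex.exp (-2 * (x : ℂ) ^ 2) *
        ∫ t : ℝ, Complex.exp (-2 * (t : ℂ) ^ 2) * (weylProduct f f x).eval (t : ℂ) := by
    intro x
    rw [convolution_def, ← integral_const_mul,
      ← integral_add_left_eq_self (fun t => L (u t) (v (2 * x - t))) x]
    congr 1 with t
    have e1 : (2 * x - (x + t)) = x - t := by ring
    rw [e1]
    simp only [L, u, v, ContinuousLinearMap.mul_apply', eval_weylProduct, map_mul,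
      ← Complex.exp_conj]
    have e2 : Complex.exp (-2 * (x : ℂ) ^ 2) * Complex.exp (-2 * (t : ℂ) ^ 2) =
        Complex.exp (-((x + t : ℝ) : ℂ) ^ 2) * Complex.exp (conj (-((x - t : ℝ) : ℂ) ^ 2)) := by
      rw [← Complex.exp_add, ← Complex.exp_add]
      congr 1
      simp
      ring
    rw [← mul_assoc (Complex.exp (-2 * (x : ℂ) ^ 2)), e2]
    push_cast
    ring
  have hint := hu.integrable_convolution L hv
  have hpos : 0 < (∫ x : ℝ, convolution u v L volume (2 * x)).re := by
    refine re_integral_pos (hint.comp_mul_left' two_ne_zero) fun x => ?_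
    have h1 : 0 < (∫ ξ : ℝ, Complex.exp (-(ξ : ℂ) ^ 2) *
        gaussianPairing ξ (weylProduct f f x)).re := by
      refine re_integral_pos (integrable_exp_mul_gaussianPairing _) fun ξ => ?_
      rw [gaussianPairing_weylProduct, ← mul_assoc, ← Complex.exp_add]
      have : (-(ξ : ℂ) ^ 2 + -(ξ : ℂ) ^ 2) = ((-ξ ^ 2 + -ξ ^ 2 : ℝ) : ℂ) := by push_cast; ring
      rw [this, ← Complex.ofReal_exp, Complex.re_ofReal_mul]
      exact mul_pos (Real.exp_pos _) (hf _)
    rw [integral_exp_mul_gaussianPairing, Complex.re_ofReal_mul] at h1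
    have h2 := pos_of_mul_pos_right h1 (Real.sqrt_nonneg _)
    rw [hconv]
    have : (-2 * (x : ℂ) ^ 2) = ((-2 * x ^ 2 : ℝ) : ℂ) := by push_cast; ring
    rw [this, ← Complex.ofReal_exp, Complex.re_ofReal_mul]
    exact mul_pos (Real.exp_pos _) h2
  intro h0
  have hu0 : ∫ t, u t = 0 := by rw [← h0, gaussianPairing_zero_apply]
  rw [Measure.integral_comp_mul_left, integral_convolution L hu hv, hu0] at hpos
  simp at hpos

/-- Hudson's theorem for polynomials times `e^{-x²/2}`: a strictly positive Wigner function forces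
the polynomial to be constant. Otherwise some coherent state is orthogonal to the function;
translating it to the origin contradicts `gaussianPairing_ne_zero_of_wignerPoly_pos`. -/
theorem natDegree_eq_zero_of_wignerPoly_pos {f : ℂ[X]}
    (hf : ∀ w, 0 < (wignerPoly f f w).re) : f.natDegree = 0 := by
  by_contra h
  obtain ⟨s, hs⟩ := exists_gaussianPairing_comp_eq_zero h
  refine gaussianPairing_ne_zero_of_wignerPoly_pos (fun w => ?_) hs
  have e : wignerPoly (f.comp (X + C s)) (f.comp (X + C s)) w = wignerPoly f f (w + s) := by
    rw [wignerPoly, wignerPoly, weylProduct, weylProduct, Polynomial.map_comp, comp_assoc,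
      comp_assoc]
    congr 3
    · simp; ring
    · simp; ring
  rw [e]
  exact hf _

/-! ### Reality and domination -/

theorem im_wignerPoly_self (f : ℂ[X]) (w : ℂ) : (wignerPoly f f w).im = 0 := by
  rw [← Complex.conj_eq_iff_im, wignerPoly, gaussianPairing_zero_apply, ← integral_conj,
    ← integral_neg_eq_self]
  congr 1 with t
  rw [eval_weylProduct, eval_weylProduct]
  simp only [map_mul, ← Complex.exp_conj, Complex.conj_conj]
  simp [sub_eq_add_neg, mul_comm]

theorem weylProduct_add_left (f g h : ℂ[X]) (w : ℂ) :
    weylProduct (f + g) h w = weylProduct f h w + weylProduct g h w := by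
  rw [weylProduct, add_comp, add_mul, weylProduct, weylProduct]

theorem weylProduct_smul_left (c : ℂ) (f g : ℂ[X]) (w : ℂ) :
    weylProduct (c • f) g w = c • weylProduct f g w := by
  rw [weylProduct, smul_comp, smul_mul_assoc, weylProduct]

/-- If the sum of the `wignerPoly (f i) (f i)` has no zero, then it dominates the term of highest
degree: both grow at the same rate at infinity, and the quotient is continuous. -/
theorem exists_norm_wignerPoly_le {ι : Type*} [Fintype ι] {f : ι → ℂ[X]} {i₀ : ι}
    (hdeg : ∀ i, (f i).degree ≤ (f i₀).degree) (h0 : f i₀ ≠ 0)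
    (hpos : ∀ w, 0 < (∑ i, wignerPoly (f i) (f i) w).re) :
    ∃ c : ℝ, 0 < c ∧ ∀ w,
      ‖wignerPoly (f i₀) (f i₀) w‖ ≤ c * (∑ i, wignerPoly (f i) (f i) w).re := by
  set n := (f i₀).natDegree
  have hn : ∀ i, (f i).natDegree ≤ n := fun i => natDegree_le_natDegree (hdeg i)
  let r : ℂ → ℝ := fun w => ‖wignerPoly (f i₀) (f i₀) w‖ / (∑ i, wignerPoly (f i) (f i) w).re
  have hcont : Continuous r := by
    refine (continuous_wignerPoly_self _).norm.div
      (Complex.continuous_re.comp (continuous_finsetSum _ fun i _ => continuous_wignerPoly_self _))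
      fun w => (hpos w).ne'
  have hden : Tendsto (fun w => (∑ i, wignerPoly (f i) (f i) w / (‖w‖ : ℂ) ^ (2 * n)).re)
      (cocompact ℂ) (𝓝 (∑ i, (Real.sqrt Real.pi * (‖(f i).coeff n‖ : ℂ) ^ 2)).re) :=
    (Complex.continuous_re.tendsto _).comp
      (tendsto_finsetSum _ fun i _ => tendsto_wignerPoly_div (hn i))
  have hlim0 : (∑ i, ((Real.sqrt Real.pi : ℂ) * (‖(f i).coeff n‖ : ℂ) ^ 2)).re ≠ 0 := by
    have e : (∑ i, ((Real.sqrt Real.pi : ℂ) * (‖(f i).coeff n‖ : ℂ) ^ 2)).re =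
        ∑ i, Real.sqrt Real.pi * ‖(f i).coeff n‖ ^ 2 := by
      rw [Complex.re_sum]
      refine Finset.sum_congr rfl fun i _ => ?_
      norm_cast
    rw [e]
    refine (Finset.sum_pos' (fun i _ => by positivity) ⟨i₀, Finset.mem_univ _, ?_⟩).ne'
    have : (f i₀).coeff n ≠ 0 := leadingCoeff_ne_zero.2 h0
    have := norm_pos_iff.2 this
    have := Real.sqrt_pos.2 Real.pi_pos
    positivity
  have hlim := (tendsto_wignerPoly_div (hn i₀)).norm.div hden hlim0
  have hne : ∀ᶠ w : ℂ in cocompact ℂ, w ≠ 0 := by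
    rw [← Metric.cobounded_eq_cocompact]
    exact Bornology.eventually_ne_cobounded 0
  have hr : Tendsto r (cocompact ℂ) _ := hlim.congr' (by
    filter_upwards [hne] with w hw
    have hw' : 0 < ‖w‖ ^ (2 * n) := pow_pos (norm_pos_iff.2 hw) _
    have e : ((‖w‖ : ℂ) ^ (2 * n)) = ((‖w‖ ^ (2 * n) : ℝ) : ℂ) := by push_cast; rfl
    simp only [Pi.div_apply, r]
    rw [← Finset.sum_div, e, Complex.div_ofReal_re, norm_div, Complex.norm_real,
      Real.norm_of_nonneg hw'.le, div_div_div_cancel_right₀ hw'.ne'])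
  -- The quotient `r` is bounded outside a compact set by its limit, inside by continuity.
  obtain ⟨A, hr_le⟩ : ∃ A, ∀ᶠ w in cocompact ℂ, r w ≤ A :=
    ⟨_, hr.eventually_le_const (lt_add_one _)⟩
  obtain ⟨K, hK, hKc⟩ := mem_cocompact.1 hr_le
  obtain ⟨B, hB⟩ := hK.exists_bound_of_continuousOn hcont.continuousOn
  refine ⟨max 1 (max B A), lt_max_of_lt_left one_pos, fun w => ?_⟩
  rw [← div_le_iff₀ (hpos w)]
  by_cases hw : w ∈ K
  · exact ((le_abs_self _).trans (hB w hw)).trans ((le_max_left _ _).trans (le_max_right _ _))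
  · exact (hKc hw).trans ((le_max_right _ _).trans (le_max_right _ _))

/-! ### Wigner functions of operators -/

theorem exists_polynomial_of_mem_fockSpace {N : ℕ} {v : L2R} (hv : v ∈ fockSpace N) :
    ∃ p : ℂ[X], v =ᵐ[volume] fun x : ℝ => p.eval (x : ℂ) * Complex.exp (-(x : ℂ) ^ 2 / 2) := by
  induction hv using Submodule.span_induction with
  | mem v hv =>
    obtain ⟨n, -, rfl⟩ := hv
    refine ⟨C ((((2 ^ n * (n.factorial : ℝ)) ^ (-(1 / 2) : ℝ) * Real.pi ^ (-(1 / 4) : ℝ) : ℝ)) :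
      ℂ) * (physHermite n).map Complex.ofRealHom, ?_⟩
    filter_upwards [(memLp_hermiteFun n).coeFn_toLp] with x hx
    have e : ((physHermite n).map Complex.ofRealHom).eval (x : ℂ) = ((physHermite n).eval x : ℝ) :=
      eval_map_apply Complex.ofRealHom x
    rw [fock, hx, hermiteFun, eval_mul, eval_C, e]
    have e2 : Complex.exp (-(x : ℂ) ^ 2 / 2) = ((Real.exp (-(1 / 2) * x ^ 2) : ℝ) : ℂ) := by
      push_cast; ring_nf
    rw [e2, ← Complex.ofReal_mul, ← Complex.ofReal_mul]
  | zero => exact ⟨0, by filter_upwards [Lp.coeFn_zero ℂ 2 volume] with x hx; simp⟩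
  | add u v _ _ hu hv =>
    obtain ⟨p, hp⟩ := hu
    obtain ⟨q, hq⟩ := hv
    refine ⟨p + q, ?_⟩
    filter_upwards [hp, hq, Lp.coeFn_add u v] with x h1 h2 h3
    rw [h3, Pi.add_apply, h1, h2, eval_add, add_mul]
  | smul c v _ hv =>
    obtain ⟨p, hp⟩ := hv
    refine ⟨c • p, ?_⟩
    filter_upwards [hp, Lp.coeFn_smul c v] with x h1 h2
    rw [h2, Pi.smul_apply, h1, eval_smul, smul_mul_assoc]

/-- The linear map `pol` sends each `v ∈ H` to a polynomial `p` such that `v(x) = p(x) e^{-x²/2}`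
for almost every `x`. -/
def IsPolynomialPart {H : Submodule ℂ L2R} (pol : H →ₗ[ℂ] ℂ[X]) : Prop :=
  ∀ v : H, (v : L2R) =ᵐ[volume]
    fun x : ℝ => (pol v).eval (x : ℂ) * Complex.exp (-(x : ℂ) ^ 2 / 2)

theorem exists_isPolynomialPart {N : ℕ} {H : Submodule ℂ L2R} (hH : H ≤ fockSpace N) :
    ∃ pol : H →ₗ[ℂ] ℂ[X], IsPolynomialPart pol := by
  let b := Module.Basis.ofVectorSpace ℂ H
  choose q hq using fun i => exists_polynomial_of_mem_fockSpace (hH (b i).2)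
  refine ⟨b.constr ℂ q, fun v => ?_⟩
  induction b.mem_span v using Submodule.span_induction with
  | mem v hv =>
    obtain ⟨i, rfl⟩ := hv
    simpa using hq i
  | zero => filter_upwards [Lp.coeFn_zero ℂ 2 volume] with x hx; simp
  | add u v _ _ hu hv =>
    filter_upwards [hu, hv, Lp.coeFn_add (u : L2R) (v : L2R)] with x h1 h2 h3
    rw [Submodule.coe_add, h3, Pi.add_apply, h1, h2, map_add, eval_add, add_mul]
  | smul c v _ hv =>
    filter_upwards [hv, Lp.coeFn_smul c (v : L2R)] with x h1 h2
    rw [Submodule.coe_smul, h2, Pi.smul_apply, h1, map_smul, eval_smul, smul_mul_assoc]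

namespace IsPolynomialPart

variable {H : Submodule ℂ L2R} {pol : H →ₗ[ℂ] ℂ[X]}

theorem ne_zero (hpol : IsPolynomialPart pol) {v : H} (hv : v ≠ 0) : pol v ≠ 0 := by
  intro h
  refine hv (Subtype.ext (Lp.ext ?_))
  filter_upwards [hpol v, Lp.coeFn_zero ℂ 2 volume] with x h1 h2
  rw [h1, h, ZeroMemClass.coe_zero, h2]
  simp

variable [FiniteDimensional ℂ H]

/-- The Wigner function does not see the choice of representatives in `L²`, since for fixed `x` both
`t ↦ x + t` and `t ↦ x - t` preserve null sets. The substitution `y = 2t` turns the defining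
integral into a `gaussianPairing`. -/
theorem wigner_eq (hpol : IsPolynomialPart pol) (ρ : H →L[ℂ] H) (x ξ : ℝ) :
    wigner ρ (x, ξ) = (Real.pi : ℂ)⁻¹ * Complex.exp (-(x : ℂ) ^ 2) * gaussianPairing ξ
      (∑ i, weylProduct (pol (ρ (stdOrthonormalBasis ℂ H i)))
        (pol (stdOrthonormalBasis ℂ H i)) x) := by
  set b := stdOrthonormalBasis ℂ H
  have hscale := Measure.integral_comp_mul_left (fun y : ℝ => Complex.exp (-Complex.I * ξ * y) *
    opKernel ρ (x + y / 2) (x - y / 2)) 2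
  have h2 : ∫ y : ℝ, Complex.exp (-Complex.I * ξ * y) * opKernel ρ (x + y / 2) (x - y / 2) =
      2 * ∫ t : ℝ, Complex.exp (-2 * Complex.I * ξ * t) * opKernel ρ (x + t) (x - t) := by
    have e : ∀ t : ℝ, Complex.exp (-Complex.I * ξ * (2 * t : ℝ)) *
        opKernel ρ (x + 2 * t / 2) (x - 2 * t / 2) =
        Complex.exp (-2 * Complex.I * ξ * t) * opKernel ρ (x + t) (x - t) := by
      intro t
      rw [mul_div_cancel_left₀ t two_ne_zero]
      push_cast
      ring_nf
    simp_rw [e] at hscale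
    rw [hscale, abs_of_pos (by norm_num), Complex.real_smul]
    push_cast
    ring
  have hplus : ∀ᵐ t : ℝ, ∀ i, ((ρ (b i) : H) : L2R) (x + t) =
      (pol (ρ (b i))).eval ((x + t : ℝ) : ℂ) * Complex.exp (-((x + t : ℝ) : ℂ) ^ 2 / 2) :=
    ae_all_iff.2 fun i =>
      (measurePreserving_add_left volume x).quasiMeasurePreserving.ae (hpol (ρ (b i)))
  have hminus : ∀ᵐ t : ℝ, ∀ i, ((b i : H) : L2R) (x - t) =
      (pol (b i)).eval ((x - t : ℝ) : ℂ) * Complex.exp (-((x - t : ℝ) : ℂ) ^ 2 / 2) :=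
    ae_all_iff.2 fun i =>
      (Measure.measurePreserving_sub_left volume x).quasiMeasurePreserving.ae (hpol (b i))
  have h3 : ∫ t : ℝ, Complex.exp (-2 * Complex.I * ξ * t) * opKernel ρ (x + t) (x - t) =
      Complex.exp (-(x : ℂ) ^ 2) * gaussianPairing ξ
        (∑ i, weylProduct (pol (ρ (b i))) (pol (b i)) x) := by
    rw [gaussianPairing_apply, ← integral_const_mul]
    refine integral_congr_ae ?_
    filter_upwards [hplus, hminus] with t hp hm
    simp only [opKernel]
    rw [eval_finsetSum, Finset.mul_sum, Finset.mul_sum, Finset.mul_sum]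
    refine Finset.sum_congr rfl fun i _ => ?_
    rw [hp i, hm i, eval_weylProduct]
    simp only [map_mul, ← Complex.exp_conj]
    have e2 : Complex.exp (-2 * Complex.I * ξ * t) * (Complex.exp (-((x + t : ℝ) : ℂ) ^ 2 / 2) *
        Complex.exp (conj (-((x - t : ℝ) : ℂ) ^ 2 / 2))) =
        Complex.exp (-(x : ℂ) ^ 2) * Complex.exp (-(t : ℂ) ^ 2 - 2 * Complex.I * ξ * t) := by
      rw [← Complex.exp_add, ← Complex.exp_add, ← Complex.exp_add]
      congr 1
      simp only [map_div₀, map_neg, map_pow, Complex.conj_ofReal, map_ofNat]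
      push_cast
      ring
    rw [← mul_assoc (Complex.exp (-(x : ℂ) ^ 2)), ← e2]
    push_cast
    ring
  rw [wigner]
  simp only
  rw [h2, h3]
  ring

theorem isLinearMap_wigner (hpol : IsPolynomialPart pol) (z : ℝ × ℝ) :
    IsLinearMap ℂ fun ρ : H →L[ℂ] H => wigner ρ z := by
  obtain ⟨x, ξ⟩ := z
  constructor
  · intro ρ σ
    simp only [hpol.wigner_eq]
    rw [← mul_add, ← map_add, ← Finset.sum_add_distrib]
    congr 2
    refine Finset.sum_congr rfl fun i _ => ?_
    rw [_root_.add_apply, map_add, weylProduct_add_left]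
  · intro c ρ
    simp only [hpol.wigner_eq]
    rw [smul_eq_mul, mul_left_comm, ← smul_eq_mul c, ← map_smul, Finset.smul_sum]
    congr 2
    refine Finset.sum_congr rfl fun i _ => ?_
    rw [_root_.smul_apply, map_smul, weylProduct_smul_left]

theorem wigner_rankOne_self (hpol : IsPolynomialPart pol) (v : H) (x ξ : ℝ) :
    wigner (InnerProductSpace.rankOne ℂ v v) (x, ξ) =
      (Real.pi⁻¹ * Real.exp (-x ^ 2) * Real.exp (-ξ ^ 2) : ℝ) *
        wignerPoly (pol v) (pol v) (x - Complex.I * ξ) := by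
  have h : ∑ i, weylProduct (pol (InnerProductSpace.rankOne ℂ v v (stdOrthonormalBasis ℂ H i)))
      (pol (stdOrthonormalBasis ℂ H i)) x = weylProduct (pol v) (pol v) x := by
    have e : (pol v).map (starRingEnd ℂ) = ∑ i, inner ℂ v (stdOrthonormalBasis ℂ H i) •
        (pol (stdOrthonormalBasis ℂ H i)).map (starRingEnd ℂ) := by
      conv_lhs => rw [← (stdOrthonormalBasis ℂ H).sum_repr' v]
      rw [map_sum pol, Polynomial.map_sum]
      refine Finset.sum_congr rfl fun i _ => ?_
      rw [map_smul, Polynomial.map_smul, inner_conj_symm]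
    conv_rhs => rw [weylProduct, e, Polynomial.sum_comp, Finset.mul_sum]
    refine Finset.sum_congr rfl fun i _ => ?_
    rw [InnerProductSpace.rankOne_apply, map_smul, weylProduct_smul_left, weylProduct, smul_comp,
      mul_smul_comm]
  rw [hpol.wigner_eq, h, gaussianPairing_weylProduct]
  push_cast
  ring

end IsPolynomialPart

/-! ### Extreme points -/

theorem rankOne_smul_self {E : Type*} [NormedAddCommGroup E] [InnerProductSpace ℂ E] (a : ℂ)
    (v : E) : rankOne ℂ (a • v) (a • v) = ((‖a‖ ^ 2 : ℝ) : ℂ) • rankOne ℂ v v := by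
  refine ContinuousLinearMap.ext fun y => ?_
  rw [rankOne_apply, _root_.smul_apply, rankOne_apply, inner_smul_left, smul_smul, smul_smul]
  push_cast
  rw [← Complex.mul_conj']
  ring_nf

theorem norm_fock_zero : ‖fock 0‖ = 1 := by
  have h : inner ℂ (fock 0) (fock 0) = (1 : ℂ) := by
    rw [L2.inner_def]
    have e : ∀ᵐ x : ℝ, inner ℂ (fock 0 x) (fock 0 x) =
        (((Real.sqrt Real.pi)⁻¹ * Real.exp (-1 * x ^ 2) : ℝ) : ℂ) := by
      filter_upwards [(memLp_hermiteFun 0).coeFn_toLp] with x hx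
      rw [fock, hx, hermiteFun, RCLike.inner_apply, Complex.conj_ofReal, ← Complex.ofReal_mul]
      congr 1
      have h1 : (Real.sqrt Real.pi)⁻¹ =
          Real.pi ^ (-(1 / 4) : ℝ) * Real.pi ^ (-(1 / 4) : ℝ) := by
        rw [← Real.rpow_add Real.pi_pos, Real.sqrt_eq_rpow, ← Real.rpow_neg Real.pi_pos.le]
        norm_num
      have h2 : Real.exp (-1 * x ^ 2) =
          Real.exp (-(1 / 2) * x ^ 2) * Real.exp (-(1 / 2) * x ^ 2) := by
        rw [← Real.exp_add]; ring_nf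
      rw [h1, h2]
      simp [physHermite]
      ring
    rw [integral_congr_ae e, integral_complex_ofReal, integral_const_mul, integral_gaussian,
      div_one, inv_mul_cancel₀ (Real.sqrt_pos.2 Real.pi_pos).ne', Complex.ofReal_one]
  rw [inner_self_eq_norm_sq_to_K] at h
  have h' : ‖fock 0‖ ^ 2 = 1 := Complex.ofReal_injective (by simpa using h)
  exact (pow_eq_one_iff_of_nonneg (norm_nonneg _) two_ne_zero).1 h'

namespace IsPolynomialPart

variable {H : Submodule ℂ L2R} {pol : H →ₗ[ℂ] ℂ[X]}

theorem exists_eq_smul_fock_zero (hpol : IsPolynomialPart pol) {v : H}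
    (hv : (pol v).natDegree = 0) : ∃ k : ℂ, (v : L2R) = k • fock 0 := by
  obtain ⟨a, ha⟩ := natDegree_eq_zero.1 hv
  refine ⟨a * ((Real.pi ^ (1 / 4 : ℝ) : ℝ) : ℂ), Lp.ext ?_⟩
  filter_upwards [hpol v, (memLp_hermiteFun 0).coeFn_toLp,
    Lp.coeFn_smul (a * ((Real.pi ^ (1 / 4 : ℝ) : ℝ) : ℂ)) (fock 0)] with x h1 h2 h3
  rw [h3, Pi.smul_apply, fock, h2, h1, ← ha, eval_C, hermiteFun, smul_eq_mul, mul_assoc,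
    ← Complex.ofReal_mul]
  have h4 : Complex.exp (-(x : ℂ) ^ 2 / 2) = ((Real.exp (-(1 / 2) * x ^ 2) : ℝ) : ℂ) := by
    push_cast; ring_nf
  have h5 : Real.pi ^ (1 / 4 : ℝ) * Real.pi ^ (-(1 / 4) : ℝ) = 1 := by
    rw [← Real.rpow_add Real.pi_pos, add_neg_cancel, Real.rpow_zero]
  rw [h4]
  congr 2
  simp only [pow_zero, Nat.factorial_zero, Nat.cast_one, mul_one, Real.one_rpow, one_mul,
    physHermite, eval_one]
  rw [← mul_assoc, h5, one_mul]

variable [FiniteDimensional ℂ H]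

/-- Wigner-positive states near `ρ`, in the direction of an operator `σ` whose Wigner function is
dominated by that of `ρ`. -/
theorem add_smul_mem_wignerPositiveStates (hpol : IsPolynomialPart pol) {ρ σ : H →L[ℂ] H}
    (hρ : ρ ∈ wignerPositiveStates H) {τ c a b : ℝ}
    (htr : LinearMap.trace ℂ H (σ : H →ₗ[ℂ] H) = τ) (him : ∀ z, (wigner σ z).im = 0)
    (hc : ∀ z, ‖wigner σ z‖ ≤ c * (wigner ρ z).re)
    (hpos : ((a : ℂ) • ρ + (b : ℂ) • σ).IsPositive) (hab : a + b * τ = 1) (hbc : |b| * c ≤ a) :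
    (a : ℂ) • ρ + (b : ℂ) • σ ∈ wignerPositiveStates H := by
  refine ⟨⟨hpos, ?_⟩, fun z => ?_⟩
  · rw [ContinuousLinearMap.toLinearMap_add, ContinuousLinearMap.toLinearMap_smul,
      ContinuousLinearMap.toLinearMap_smul, map_add, map_smul, map_smul, htr, hρ.1.2]
    simp only [smul_eq_mul, mul_one]
    exact_mod_cast hab
  · have hL := hpol.isLinearMap_wigner z
    have e := (hL.map_add ((a : ℂ) • ρ) ((b : ℂ) • σ)).trans
      (congrArg₂ (· + ·) (hL.map_smul (a : ℂ) ρ) (hL.map_smul (b : ℂ) σ))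
    simp only [smul_eq_mul] at e
    have h0 := Complex.nonneg_iff.1 (hρ.2 z)
    rw [e, Complex.nonneg_iff]
    constructor
    · rw [Complex.add_re, Complex.re_ofReal_mul, Complex.re_ofReal_mul]
      have h1 : |b * (wigner σ z).re| ≤ |b| * (c * (wigner ρ z).re) := by
        rw [abs_mul]
        exact mul_le_mul_of_nonneg_left ((Complex.abs_re_le_norm _).trans (hc z)) (abs_nonneg b)
      have h2 := mul_le_mul_of_nonneg_right hbc h0.1
      linarith [neg_abs_le (b * (wigner σ z).re)]
    · rw [Complex.add_im, Complex.im_ofReal_mul, Complex.im_ofReal_mul, him, ← h0.2]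
      simp

/-- If `0 ≤ σ ≤ ρ` and the Wigner function of `σ` is dominated by that of the extreme point `ρ`,
then `σ` is a multiple of `ρ`: otherwise `ρ` is the midpoint of the distinct Wigner-positive states
`ρ ± ε (σ - τ ρ)`, where `τ` is the trace of `σ`. -/
theorem eq_smul_of_mem_extremePoints (hpol : IsPolynomialPart pol) {ρ σ : H →L[ℂ] H}
    (hρ : ρ ∈ (wignerPositiveStates H).extremePoints ℝ) (hσ : σ.IsPositive)
    (hle : (ρ - σ).IsPositive) {τ c : ℝ} (hτ : 0 ≤ τ) (hc0 : 0 < c)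
    (htr : LinearMap.trace ℂ H (σ : H →ₗ[ℂ] H) = τ) (him : ∀ z, (wigner σ z).im = 0)
    (hc : ∀ z, ‖wigner σ z‖ ≤ c * (wigner ρ z).re) : σ = (τ : ℂ) • ρ := by
  obtain ⟨hmem, hext⟩ := mem_extremePoints.1 hρ
  -- `ε τ + ε c ≤ 1` keeps the Wigner functions nonnegative, `ε ≤ 1` keeps `ρ - ε σ` positive.
  obtain ⟨ε, hε, hε1⟩ : ∃ ε : ℝ, 0 < ε ∧ ε + ε * τ + ε * c = 1 :=
    ⟨(1 + τ + c)⁻¹, by positivity, by field_simp⟩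
  have hετ : 0 ≤ ε * τ := by positivity
  have hεc : 0 ≤ ε * c := by positivity
  have hle1 : ((1 - ε * τ : ℝ) : ℂ) • ρ + ((ε : ℝ) : ℂ) • σ ∈ wignerPositiveStates H := by
    refine hpol.add_smul_mem_wignerPositiveStates hmem htr him hc ?_ (by ring) ?_
    · refine (hmem.1.1.smul_of_nonneg ?_).add (hσ.smul_of_nonneg ?_)
      · exact Complex.zero_le_real.2 (by linarith)
      · exact Complex.zero_le_real.2 hε.le
    · rw [abs_of_pos hε]
      linarith
  have hle2 : ((1 + ε * τ : ℝ) : ℂ) • ρ + ((-ε : ℝ) : ℂ) • σ ∈ wignerPositiveStates H := by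
    refine hpol.add_smul_mem_wignerPositiveStates hmem htr him hc ?_ (by ring) ?_
    · have e : ((1 + ε * τ : ℝ) : ℂ) • ρ + ((-ε : ℝ) : ℂ) • σ =
          ((1 + ε * τ - ε : ℝ) : ℂ) • ρ + ((ε : ℝ) : ℂ) • (ρ - σ) := by
        push_cast
        module
      rw [e]
      refine (hmem.1.1.smul_of_nonneg ?_).add (hle.smul_of_nonneg ?_)
      · exact Complex.zero_le_real.2 (by linarith)
      · exact Complex.zero_le_real.2 hε.le
    · rw [abs_neg, abs_of_pos hε]
      linarith
  have hseg : ρ ∈ openSegment ℝ (((1 - ε * τ : ℝ) : ℂ) • ρ + ((ε : ℝ) : ℂ) • σ)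
      (((1 + ε * τ : ℝ) : ℂ) • ρ + ((-ε : ℝ) : ℂ) • σ) := by
    refine ⟨1 / 2, 1 / 2, by norm_num, by norm_num, by norm_num, ?_⟩
    have hreal : ∀ (r : ℝ) (T : H →L[ℂ] H), r • T = (r : ℂ) • T := fun r T =>
      ContinuousLinearMap.ext fun y => (Complex.coe_smul r (T y)).symm
    rw [hreal, hreal]
    push_cast
    module
  have h := (hext _ hle1 _ hle2 hseg).1
  have h2 : (ε : ℂ) • (σ - (τ : ℂ) • ρ) = 0 := by
    rw [← sub_eq_zero] at h
    rw [← h]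
    push_cast
    module
  exact sub_eq_zero.1 ((smul_eq_zero.1 h2).resolve_left (by exact_mod_cast hε.ne'))

theorem wigner_sum_rankOne (hpol : IsPolynomialPart pol) {ι : Type*} [Fintype ι] (u : ι → H)
    (x ξ : ℝ) : wigner (∑ i, rankOne ℂ (u i) (u i)) (x, ξ) =
      (Real.pi⁻¹ * Real.exp (-x ^ 2) * Real.exp (-ξ ^ 2) : ℝ) *
        ∑ i, wignerPoly (pol (u i)) (pol (u i)) (x - Complex.I * ξ) := by
  have h := map_sum ((hpol.isLinearMap_wigner (x, ξ)).mk' _) (fun i => rankOne ℂ (u i) (u i))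
    Finset.univ
  simp only [IsLinearMap.mk'_apply] at h
  rw [h, Finset.mul_sum]
  exact Finset.sum_congr rfl fun i _ => hpol.wigner_rankOne_self (u i) x ξ

/-- An extreme point without nodes is the projector onto the Gaussian. -/
theorem exists_eq_rankOne_fock_zero (hpol : IsPolynomialPart pol) {ρ : H →L[ℂ] H}
    (hρ : ρ ∈ (wignerPositiveStates H).extremePoints ℝ) (hnodal : ¬ (nodalSet ρ).Nonempty) :
    ∃ h0 : fock 0 ∈ H, ρ = rankOne ℂ (⟨fock 0, h0⟩ : H) (⟨fock 0, h0⟩ : H) := by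
  have hmem : ρ ∈ wignerPositiveStates H := hρ.1
  obtain ⟨m, u, hu⟩ := ContinuousLinearMap.isPositive_iff_eq_sum_rankOne.1 hmem.1.1
  have hne : ∃ k, u k ≠ 0 := by
    by_contra! h
    have h1 := hmem.1.2
    rw [hu] at h1
    rw [Finset.sum_eq_zero fun i _ => rankOne_eq_zero.2 (Or.inl (h i))] at h1
    simp at h1
  obtain ⟨k, hk⟩ := hne
  have : Nonempty (Fin m) := ⟨k⟩
  -- The summand of highest degree is the one whose Wigner function controls the growth of `Wρ`.
  obtain ⟨i₀, hi₀⟩ := Finite.exists_max fun i => (pol (u i)).degree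
  have hp0 : pol (u i₀) ≠ 0 := by
    intro h
    have := hi₀ k
    rw [h, degree_zero, le_bot_iff, degree_eq_bot] at this
    exact hpol.ne_zero hk this
  have hu0 : u i₀ ≠ 0 := fun h => hp0 (by rw [h, map_zero])
  have hW : ∀ x ξ : ℝ, wigner ρ (x, ξ) =
      (Real.pi⁻¹ * Real.exp (-x ^ 2) * Real.exp (-ξ ^ 2) : ℝ) *
        ∑ i, wignerPoly (pol (u i)) (pol (u i)) (x - Complex.I * ξ) := fun x ξ => by
    rw [hu, hpol.wigner_sum_rankOne]
  have hg : ∀ x ξ : ℝ, 0 < Real.pi⁻¹ * Real.exp (-x ^ 2) * Real.exp (-ξ ^ 2) := fun x ξ => by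
    have := Real.pi_pos
    positivity
  have hw : ∀ w : ℂ, ((w.re : ℂ) - Complex.I * ((-w.im : ℝ) : ℂ)) = w := fun w => by
    apply Complex.ext <;> simp
  have hpos : ∀ w, 0 < (∑ i, wignerPoly (pol (u i)) (pol (u i)) w).re := by
    intro w
    have h1 : 0 < wigner ρ (w.re, -w.im) :=
      lt_of_le_of_ne (hmem.2 _) fun h => hnodal ⟨_, h.symm⟩
    have h2 := (Complex.pos_iff.1 h1).1
    rw [hW, Complex.re_ofReal_mul, hw] at h2
    exact pos_of_mul_pos_right h2 (hg _ _).le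
  obtain ⟨c, hc0, hc⟩ := exists_norm_wignerPoly_le hi₀ hp0 hpos
  have hσ : rankOne ℂ (u i₀) (u i₀) = ((‖u i₀‖ ^ 2 : ℝ) : ℂ) • ρ := by
    refine hpol.eq_smul_of_mem_extremePoints hρ (isPositive_rankOne_self _) ?_ (by positivity) hc0
      ?_ ?_ ?_
    · rw [hu, ← Finset.add_sum_erase _ _ (Finset.mem_univ i₀), add_sub_cancel_left]
      exact ContinuousLinearMap.isPositive_sum _ fun i _ => isPositive_rankOne_self _
    · rw [trace_rankOne, inner_self_eq_norm_sq_to_K]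
      push_cast
      rfl
    · rintro ⟨x, ξ⟩
      rw [hpol.wigner_rankOne_self, Complex.im_ofReal_mul, im_wignerPoly_self, mul_zero]
    · rintro ⟨x, ξ⟩
      rw [hpol.wigner_rankOne_self, hW, norm_mul, Complex.norm_real,
        Real.norm_of_nonneg (hg x ξ).le, Complex.re_ofReal_mul, mul_left_comm]
      exact mul_le_mul_of_nonneg_left (hc _) (hg x ξ).le
  have hτ : (0 : ℝ) < ‖u i₀‖ ^ 2 := by
    have := norm_pos_iff.2 hu0
    positivity
  -- Since `ρ` is a multiple of `|u i₀⟩⟨u i₀|`, the latter has a positive Wigner function as well.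
  have hpure : ∀ w, 0 < (wignerPoly (pol (u i₀)) (pol (u i₀)) w).re := by
    intro w
    have h1 := hpol.wigner_rankOne_self (u i₀) w.re (-w.im)
    have h2 := (hpol.isLinearMap_wigner (w.re, -w.im)).map_smul ((‖u i₀‖ ^ 2 : ℝ) : ℂ) ρ
    rw [hσ, h2, hW, hw, smul_eq_mul, mul_left_comm] at h1
    have h3 := mul_left_cancel₀ (by exact_mod_cast (hg _ _).ne') h1
    rw [← h3, Complex.re_ofReal_mul]
    exact mul_pos hτ (hpos w)
  obtain ⟨a, ha⟩ := hpol.exists_eq_smul_fock_zero (natDegree_eq_zero_of_wignerPoly_pos hpure)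
  have ha0 : a ≠ 0 := by
    rintro rfl
    exact hu0 (Subtype.ext (by rw [ha, zero_smul]; rfl))
  have h0 : fock 0 ∈ H := by
    have : fock 0 = a⁻¹ • (u i₀ : L2R) := by rw [ha, smul_smul, inv_mul_cancel₀ ha0, one_smul]
    rw [this]
    exact H.smul_mem _ (u i₀).2
  refine ⟨h0, ?_⟩
  have hv : u i₀ = a • (⟨fock 0, h0⟩ : H) := Subtype.ext ha
  have hn : ‖(⟨fock 0, h0⟩ : H)‖ = 1 := norm_fock_zero
  have ht : ((‖u i₀‖ ^ 2 : ℝ) : ℂ) ≠ 0 := by exact_mod_cast hτ.ne'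
  refine smul_right_injective _ ht ?_
  simp only
  rw [← hσ, hv, norm_smul, hn, mul_one]
  exact rankOne_smul_self a _

end IsPolynomialPart

end

theorem mainTheorem5 (N : ℕ) (H : Submodule ℂ L2R) (hH : H ≤ fockSpace N) :
    haveI : FiniteDimensional ℂ H := finiteDimensional_of_le_fockSpace hH
    (∀ h0 : fock 0 ∈ H,
      (wignerPositiveStates H).extremePoints ℝ ⊆
        nodalWignerPositiveStates H ∪
          {InnerProductSpace.rankOne ℂ (⟨fock 0, h0⟩ : H) (⟨fock 0, h0⟩ : H)}) ∧
    (fock 0 ∉ H →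
      (wignerPositiveStates H).extremePoints ℝ ⊆ nodalWignerPositiveStates H) := by
  have : FiniteDimensional ℂ H := finiteDimensional_of_le_fockSpace hH
  obtain ⟨pol, hpol⟩ := exists_isPolynomialPart hH
  refine ⟨fun h0 ρ hρ => ?_, fun h0 ρ hρ => ?_⟩
  · by_cases hn : (nodalSet ρ).Nonempty
    · exact Or.inl ⟨hρ.1, hn⟩
    · exact Or.inr (hpol.exists_eq_rankOne_fock_zero hρ hn).2
  · by_contra h
    exact h0 (hpol.exists_eq_rankOne_fock_zero hρ fun hn => h ⟨hρ.1, hn⟩).1
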